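/- Let $\mathcal N$ be a finite set of agents and $\mathcal A$ a finite set of alternatives with $|\mathcal A|\ge 3$. A type of an agent is a preference $\succcurlyeq$ over $\mathcal A\times\mathbb R$ (alternative, own payment) that is represented by some utility function $u:\mathcal A\times\mathbb R\to\mathbb R$ strictly decreasing in the payment. A utility function $u$ is quasi-linear if $u(a,z)=v(a)-z$ for some $v:\mathcal A\to\mathbb R$; it pos-represents $\succcurlyeq$ if $(a,z)\succcurlyeq(b,y)\iff u(a,z)\ge u(b,y)$ whenever $u(a,z)\ge0$ or $u(b,y)\ge0$. For each $i\in\mathcal N$ let $T_i$ be a set of types and $\varphi_i$ a bijection from $T_i$ onto the set of quasi-linear $u$ with $\min_{a}u(a,0)=0$, such that every $t\in T_i$ is pos-represented by $\varphi_i(t)$. A (direct, deterministic) mechanism $M=\langle x,p\rangle$ consists of $x:\prod_iT_i\to\mathcal A$ and $p:\prod_iT_i\to\mathbb R^{\mathcal N}$; it is incentive compatible if for all $t$, $i$ and $s\in T_i$, the outcome $(x(t),p_i(t))$ is weakly preferred according to $t_i$ to $(x(s,t_{-i}),p_i(s,t_{-i}))$. A randomized mechanism is a lottery over mechanisms, i.e.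 a probability space of coin flips $\omega$ and a mechanism $M_\omega=\langle x_\omega,p_\omega\rangle$ for every $\omega$ (with $x_\omega(t)$ and $p_{\omega,i}(t)$ measurable in $\omega$). It is universally truthful if $M_\omega$ is incentive compatible for every $\omega$. Suppose that a randomized mechanism is universally truthful and that for every $\omega$ the map $x_\omega$ is onto $\mathcal A$ and $p_{\omega,i}(t)\le[\varphi_i(t_i)](x_\omega(t),0)$ for all profiles $t$ and agents $i$. Then it is a lottery over VCG mechanisms for pos-representations: for every $\omega$, $M_\omega=\langle x,p\rangle$ admits weights $w\in[0,1]^{\mathcal N}$ with $\sum_iw_i=1$ and costs $c\in\mathbb R^{\mathcal A}$ such that, for any choice of quasi-linear pos-representations $u_i=u_i^{t_i}$ of the types $t_i\in T_i$ (with $u_i^{t_i}$ depending only on $i$ and $t_i$), for all $t$, $$a^\star:=x(t)\in\operatorname*{argmax}_{a\in\mathcal A}\Bigl(c_a+\sum_{i}w_i\,u_i(a,0)\Bigr),$$ and for every agent $i$ there is a function $h_i$ of the other agents' types $t_{-i}$ such that, for all $t$: * if $w_i>0$, then $p_i(t)=h_i(t_{-i})-\frac1{w_i}\Bigl(c_{a^\star}+\sum_{j\ne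 i}w_j\,u_j(a^\star,0)\Bigr)$; * if $w_i=0$ and agent $i$ has no influence on the chosen alternative given $t_{-i}$ (i.e. $x(s,t_{-i})=x(t)$ for all $s\in T_i$; for instance whenever the maximizer above is unique), then $p_i(t)=h_i(t_{-i})$; * if $w_i=0$ and agent $i$'s report does influence how a tie between maximizers is broken, then $p_i(t)$ depends on $t_i$ only through the chosen alternative: $p_i(s,t_{-i})=p_i(t)$ whenever $x(s,t_{-i})=x(t)$. -/

import Mathlib

namespace PosRepMech

/-- A (candidate) preference over outcomes `(a, z)`: alternative `a`, own payment `z`.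
`R (a, z) (b, y)` reads "`(a, z)` is weakly preferred to `(b, y)`". -/
abbrev Pref (A : Type*) := A × ℝ → A × ℝ → Prop

/-- A utility function `u : A × ℝ → ℝ`, curried. -/
abbrev Util (A : Type*) := A → ℝ → ℝ

/-- `u` represents the preference `R`. -/
def Represents {A : Type*} (u : Util A) (R : Pref A) : Prop :=
  ∀ (a b : A) (za zb : ℝ), R (a, za) (b, zb) ↔ u b zb ≤ u a za

/-- `u` pos-represents `R`: it represents `R` whenever one of the two utilities is nonnegative. -/
def PosRepresents {A : Type*} (u : Util A) (R : Pref A) : Prop :=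
  ∀ (a b : A) (za zb : ℝ), (0 ≤ u a za ∨ 0 ≤ u b zb) →
    (R (a, za) (b, zb) ↔ u b zb ≤ u a za)

/-- The types: preferences represented by some utility function that is strictly decreasing
in the payment. -/
def admissibleTypes (A : Type*) : Set (Pref A) :=
  {R | ∃ u : Util A, (∀ a, StrictAnti (u a)) ∧ Represents u R}

/-- Quasi-linear utility functions `u (a, z) = v a - z`. -/
def IsQuasiLinear {A : Type*} (u : Util A) : Prop :=
  ∃ v : A → ℝ, ∀ a z, u a z = v a - z

/-- Quasi-linear utility functions with `min_a u (a, 0) = 0`. -/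
def normalizedQL (A : Type*) : Set (Util A) :=
  {u | IsQuasiLinear u ∧ IsLeast (Set.range fun a => u a 0) 0}

section Mechanisms

variable {ι A : Type*}

/-- Type profiles for the type domains `T i`. -/
abbrev Profile (T : ι → Set (Pref A)) := ∀ i, T i

/-- Profiles of the types of all agents but `i`. -/
abbrev OthersProfile (T : ι → Set (Pref A)) (i : ι) := ∀ j : {j : ι // j ≠ i}, T j.1

/-- The part `t₋ᵢ` of a profile. -/
def others {T : ι → Set (Pref A)} (t : Profile T) (i : ι) : OthersProfile T i :=
  fun j => t j.1

/-- A direct deterministic mechanism with monetary transfers. -/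
structure Mechanism (T : ι → Set (Pref A)) where
  /-- the chosen alternative -/
  x : Profile T → A
  /-- the payments of the agents -/
  p : Profile T → ι → ℝ

namespace Mechanism

variable {T : ι → Set (Pref A)}

/-- Every alternative is the outcome of some report vector. -/
def Onto (M : Mechanism T) : Prop := Function.Surjective M.x

/-- Truthful reporting is a dominant strategy: whatever the others report, agent `i` weakly
prefers (according to her true type `t i`) the outcome of reporting `t i` to that of `s`. -/
def IncentiveCompatible [DecidableEq ι] (M : Mechanism T) : Prop :=
  ∀ (t : Profile T) (i : ι) (s : T i),
    (t i).1 (M.x t, M.p t i)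
      (M.x (Function.update t i s), M.p (Function.update t i s) i)

/-- Given the reports `t₋ᵢ` of the others, the report of agent `i` does not influence the
chosen alternative. -/
def NoInfluence [DecidableEq ι] (M : Mechanism T) (t : Profile T) (i : ι) : Prop :=
  ∀ s : T i, M.x (Function.update t i s) = M.x t

/-- `U` selects for every agent and every type a quasi-linear pos-representation. -/
def IsPosRepChoice (T : ι → Set (Pref A)) (U : ∀ i, T i → Util A) : Prop :=
  ∀ i (s : T i), IsQuasiLinear (U i s) ∧ PosRepresents (U i s) s.1

/-- `M` is the weighted VCG mechanism with feasible alternatives `A'`, agent weights `w` and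
alternative costs `c`, run on the quasi-linear pos-representations selected by `U`.
An agent of weight zero pays `h (t₋ᵢ)` whenever her report has no influence on the chosen
alternative; if her report influences how a tie between maximizers is broken, her payment
depends on her report only through the chosen alternative. -/
def IsVCGWith [Fintype ι] [DecidableEq ι] (M : Mechanism T) (A' : Set A) (w : ι → ℝ)
    (c : A → ℝ) (U : ∀ i, T i → Util A) : Prop :=
  (∀ t, M.x t ∈ A' ∧ ∀ a ∈ A',
    c a + ∑ i, w i * U i (t i) a 0 ≤ c (M.x t) + ∑ i, w i * U i (t i) (M.x t) 0) ∧
  ∀ i, ∃ h : OthersProfile T i → ℝ, ∀ t,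
    (0 < w i → M.p t i = h (others t i) -
      1 / w i * (c (M.x t) + ∑ j ∈ Finset.univ.erase i, w j * U j (t j) (M.x t) 0)) ∧
    (w i = 0 →
      (M.NoInfluence t i → M.p t i = h (others t i)) ∧
      ∀ s : T i, M.x (Function.update t i s) = M.x t →
        M.p (Function.update t i s) i = M.p t i)

/-- `M` is a pos-representation VCG mechanism for `A'`, `w`, `c`: every type has a quasi-linear
pos-representation, and `M` follows the VCG rule for any choice of pos-representations (the
choice only shifts the functions `h`). -/
def IsPosRepVCG [Fintype ι] [DecidableEq ι] (M : Mechanism T) (A' : Set A) (w : ι → ℝ)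
    (c : A → ℝ) : Prop :=
  A'.Nonempty ∧ w ∈ stdSimplex ℝ ι ∧
  (∃ U, IsPosRepChoice T U) ∧ ∀ U, IsPosRepChoice T U → M.IsVCGWith A' w c U

end Mechanism

/-- A randomized mechanism: a lottery over deterministic mechanisms. The coin flips are the
points of a probability space `Ω`, and `mech ω` is the mechanism run under the coin flips `ω`. -/
structure RandomizedMechanism (T : ι → Set (Pref A)) (Ω : Type*) [MeasurableSpace Ω] where
  /-- the law of the coin flips -/
  prob : MeasureTheory.ProbabilityMeasure Ω
  /-- the realized mechanism -/
  mech : Ω → Mechanism T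
  measurable_x : ∀ t a, MeasurableSet {ω | (mech ω).x t = a}
  measurable_p : ∀ t i, Measurable fun ω => (mech ω).p t i

namespace RandomizedMechanism

variable {T : ι → Set (Pref A)} {Ω : Type*} [MeasurableSpace Ω]

/-- `R` is a lottery over mechanisms from the class `C`. -/
def IsLotteryOver (R : RandomizedMechanism T Ω) (C : Set (Mechanism T)) : Prop :=
  ∀ ω, R.mech ω ∈ C

/-- Truth-telling is a dominant strategy for all coin flips. -/
def UniversallyTruthful [DecidableEq ι] (R : RandomizedMechanism T Ω) : Prop :=
  ∀ ω, (R.mech ω).IncentiveCompatible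

end RandomizedMechanism

end Mechanisms

end PosRepMech

/-! The payment bound makes the truthful outcome's utility under `φ` nonnegative, which is where a
pos-representation decides comparisons. Hence incentive compatibility becomes the quasi-linear
inequality (`IncentiveCompatible.utility_le`). Normalized utilities cover all valuations up to
additive constants, which do not affect incentives, so each realized choice rule induces one on the
unrestricted domain, and Roberts' theorem applies.

For Roberts' theorem, consider the difference vectors at which `x` is chosen over `y`. Once opened
up and translated by a threshold, these sets coincide for all pairs, thanks to a third alternative.
The common set is an open convex cone avoiding zero: a separating functional gives the weights
(`exists_weights_of_cone`), and additivity of the thresholds gives the costs.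

Payments of agents with positive weight follow from revenue equivalence
(`payment_add_externality_le`). For weight zero it suffices that a payment depends on the own report
only through the alternative. Other pos-representations differ from `φ` by constants
(`PosRepresents.sub_eq_sub`), which is harmless throughout. -/

namespace PosRepMech

/-! ### Roberts' theorem: positive association and difference sets -/

section Roberts

variable {ι A : Type*}

/-- Positive association of differences: raising the chosen alternative strictly more than all
others, for every agent, does not change the choice. -/
def PositiveAssociation (f : (ι → A → ℝ) → A) : Prop :=
  ∀ v v' : ι → A → ℝ,
    (∀ i b, b ≠ f v → v' i b - v i b < v' i (f v) - v i (f v)) → f v' = f v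

/-- The vectors of value differences between `x` and `y` at which `x` is chosen. -/
def diffSet (f : (ι → A → ℝ) → A) (x y : A) : Set (ι → ℝ) :=
  {α | ∃ v, f v = x ∧ ∀ i, v i x - v i y = α i}

/-- The vectors that stay in `diffSet f x y` after some uniform decrease. -/
def openDiffSet (f : (ι → A → ℝ) → A) (x y : A) : Set (ι → ℝ) :=
  {α | ∃ ε : ℝ, 0 < ε ∧ (fun i => α i - ε) ∈ diffSet f x y}

/-- Agents switch from `v` to `v'` one at a time. If a switch changed the choice, adding the two
incentive constraints would show that the new alternative gained at least as much as the old one. -/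
theorem positiveAssociation_of_incentiveCompatible [Fintype ι] [DecidableEq ι]
    {f : (ι → A → ℝ) → A} {p : (ι → A → ℝ) → ι → ℝ}
    (hIC : ∀ v i s, v i (f (Function.update v i s)) - p (Function.update v i s) i
      ≤ v i (f v) - p v i) : PositiveAssociation f := by
  intro v v' h
  have key : ∀ s : Finset ι, f (s.piecewise v' v) = f v := by
    intro s
    induction s using Finset.induction_on with
    | empty => simp
    | insert j s hj ih =>
      rw [Finset.piecewise_insert]
      set u := s.piecewise v' v with hu
      have huj : u j = v j := by simp [hu, hj]
      have h1 := hIC u j (v' j)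
      have h2 := hIC (Function.update u j (v' j)) j (u j)
      simp only [Function.update_idem, Function.update_eq_self, Function.update_self] at h2
      by_contra hne
      have h3 := h j _ hne
      rw [ih, huj] at h1
      rw [ih] at h2
      linarith
  simpa using key Finset.univ

variable {f : (ι → A → ℝ) → A}

theorem PositiveAssociation.ne_of_diff_lt [Fintype ι] (hf : PositiveAssociation f) {x y : A}
    (hxy : x ≠ y) {v v' : ι → A → ℝ} (hv : f v = x)
    (h : ∀ i, v i x - v i y < v' i x - v' i y) : f v' ≠ y := by
  classical
  intro hv'
  -- At `u` the lead of `x` over `y` is midway between its values at `v` and `v'`, and all else is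
  -- pushed down. Positive association then applies from `v` and from `v'`, forcing both `x` and
  -- `y`.
  let m : ι → ℝ := fun i => ((v i x - v i y) + (v' i x - v' i y)) / 2
  let u : ι → A → ℝ := fun i z =>
    if z = x then m i else if z = y then 0 else
      min (v i z + m i - v i x) (v' i z - v' i y) - 1
  have hux : ∀ i, u i x = m i := fun i => by simp [u]
  have huy : ∀ i, u i y = 0 := fun i => by simp [u, hxy.symm]
  have huz : ∀ i z, z ≠ x → z ≠ y →
      u i z = min (v i z + m i - v i x) (v' i z - v' i y) - 1 := fun i z h1 h2 => by
    simp [u, h1, h2]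
  have hm : ∀ i, m i = ((v i x - v i y) + (v' i x - v' i y)) / 2 := fun i => rfl
  have h1 : f u = f v := by
    apply hf
    intro i b hb
    rw [hv] at hb ⊢
    by_cases hby : b = y
    · subst hby
      rw [hux, huy]; linarith [h i, hm i]
    · rw [hux, huz i b hb hby]
      linarith [min_le_left (v i b + m i - v i x) (v' i b - v' i y)]
  have h2 : f u = f v' := by
    apply hf
    intro i b hb
    rw [hv'] at hb ⊢
    by_cases hbx : b = x
    · subst hbx
      rw [hux, huy]; linarith [h i, hm i]
    · rw [huy, huz i b hbx hb]
      linarith [min_le_right (v i b + m i - v i x) (v' i b - v' i y)]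
  exact hxy (by rw [← hv, ← hv', ← h1, ← h2])

theorem PositiveAssociation.add_mem_diffSet (hf : PositiveAssociation f) {x y : A}
    (hxy : x ≠ y) {α β : ι → ℝ} (hα : α ∈ diffSet f x y) (h : ∀ i, α i < β i) :
    β ∈ diffSet f x y := by
  classical
  obtain ⟨v, hv, hvα⟩ := hα
  refine ⟨fun i z => if z = x then v i x + (β i - α i) else v i z, ?_, fun i => ?_⟩
  · rw [← hv]
    apply hf
    intro i b hb
    rw [hv] at hb ⊢
    simp only [hb, if_true, if_false]
    linarith [h i]
  · simp only [if_true, hxy.symm, if_false]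
    linarith [hvα i]

/-- Values that are prescribed on a set of alternatives containing `x` extend to all alternatives
in such a way that no other alternative is chosen. -/
theorem PositiveAssociation.exists_extension [Fintype ι] (hf : PositiveAssociation f)
    (hs : Function.Surjective f) {x : A} {S : Set A} (hx : x ∈ S) (g : ι → A → ℝ) :
    ∃ v, (∀ i, ∀ a ∈ S, v i a = g i a) ∧ f v ∈ S := by
  classical
  obtain ⟨u, hu⟩ := hs x
  -- Outside `S`, `x` leads by one more than at `u`, where it is chosen.
  let v : ι → A → ℝ := fun i a => if a ∈ S then g i a else g i x - (u i x - u i a) - 1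
  refine ⟨v, fun i a ha => by simp [v, ha], ?_⟩
  by_contra hv
  have hne : x ≠ f v := fun h => hv (h ▸ hx)
  refine hf.ne_of_diff_lt hne hu (v' := v) (fun i => ?_) rfl
  have h1 : v i x = g i x := by simp [v, hx]
  have h2 : v i (f v) = g i x - (u i x - u i (f v)) - 1 := by
    change (if f v ∈ S then _ else _) = _
    rw [if_neg hv]
  rw [h1, h2]; linarith

theorem PositiveAssociation.diffSet_disjoint [Fintype ι] (hf : PositiveAssociation f) {x y : A}
    (hxy : x ≠ y) {α β : ι → ℝ} (hα : α ∈ diffSet f x y) (hβ : β ∈ diffSet f y x) :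
    ¬ ∀ i, α i + β i < 0 := by
  intro h
  obtain ⟨v, hv, hvα⟩ := hα
  obtain ⟨u, hu, huβ⟩ := hβ
  exact hf.ne_of_diff_lt hxy hv (v' := u)
    (fun i => by linarith [h i, hvα i, huβ i]) hu

theorem PositiveAssociation.neg_mem_diffSet [Fintype ι] (hf : PositiveAssociation f)
    (hs : Function.Surjective f) {x y : A} (hxy : x ≠ y) {α : ι → ℝ}
    (hα : α ∉ diffSet f x y) : -α ∈ diffSet f y x := by
  classical
  obtain ⟨v, hvg, hv⟩ := hf.exists_extension hs (x := x) (S := {x, y}) (by simp)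
    (fun i a => if a = x then α i else 0)
  have h1 : ∀ i, v i x = α i := fun i => by rw [hvg i x (by simp)]; simp
  have h2 : ∀ i, v i y = 0 := fun i => by rw [hvg i y (by simp)]; simp [hxy.symm]
  rcases hv with hv | hv
  · exact absurd ⟨v, hv, fun i => by rw [h1, h2, sub_zero]⟩ hα
  · exact ⟨v, hv, fun i => by rw [h1, h2]; simp⟩

theorem PositiveAssociation.diffSet_trans [Fintype ι] (hf : PositiveAssociation f)
    (hs : Function.Surjective f) {x y z : A} (hxy : x ≠ y) (hyz : y ≠ z) (hxz : x ≠ z)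
    {α β δ : ι → ℝ} (hα : α ∈ diffSet f x y) (hβ : β ∈ diffSet f y z)
    (h : ∀ i, α i + β i < δ i) : δ ∈ diffSet f x z := by
  classical
  obtain ⟨u, hu, huα⟩ := hα
  obtain ⟨u', hu', huβ⟩ := hβ
  obtain ⟨v, hvg, hv⟩ := hf.exists_extension hs (x := x) (S := {x, y, z}) (by simp)
    -- The surplus `δ - α - β` is split evenly: `x` leads `y` by more than `α`, and `y` leads `z` by
    -- more than `β`.
    (fun i a => if a = x then δ i else if a = y then (δ i - α i + β i) / 2 else 0)
  have h1 : ∀ i, v i x = δ i := fun i => by rw [hvg i x (by simp)]; simp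
  have h2 : ∀ i, v i y = (δ i - α i + β i) / 2 := fun i => by
    rw [hvg i y (by simp)]; simp [hxy.symm]
  have h3 : ∀ i, v i z = 0 := fun i => by
    rw [hvg i z (by simp)]; simp [hxz.symm, hyz.symm]
  rcases hv with hv | hv | hv
  · exact ⟨v, hv, fun i => by rw [h1, h3, sub_zero]⟩
  · exact absurd hv (hf.ne_of_diff_lt hxy hu
      (fun i => by rw [h1, h2, huα]; linarith [h i]))
  · exact absurd hv (hf.ne_of_diff_lt hyz hu'
      (fun i => by rw [h3, h2, huβ]; linarith [h i]))

theorem PositiveAssociation.mem_openDiffSet (hf : PositiveAssociation f) {x y : A}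
    (hxy : x ≠ y) {α β : ι → ℝ} {ε : ℝ} (hε : 0 < ε) (hα : α ∈ diffSet f x y)
    (h : ∀ i, α i + ε ≤ β i) : β ∈ openDiffSet f x y :=
  ⟨ε / 2, by linarith, hf.add_mem_diffSet hxy hα fun i => by linarith [h i]⟩

theorem PositiveAssociation.openDiffSet_mono (hf : PositiveAssociation f) {x y : A}
    (hxy : x ≠ y) {α β : ι → ℝ} (hα : α ∈ openDiffSet f x y) (h : ∀ i, α i ≤ β i) :
    β ∈ openDiffSet f x y := by
  obtain ⟨ε, hε, hα⟩ := hα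
  exact hf.mem_openDiffSet hxy hε hα fun i => by linarith [h i]

theorem PositiveAssociation.exists_sub_mem_openDiffSet (hf : PositiveAssociation f) {x y : A}
    (hxy : x ≠ y) {α : ι → ℝ} (hα : α ∈ openDiffSet f x y) :
    ∃ ε : ℝ, 0 < ε ∧ (fun i => α i - ε) ∈ openDiffSet f x y := by
  obtain ⟨ε, hε, hα⟩ := hα
  exact ⟨ε / 2, by linarith, hf.mem_openDiffSet hxy (ε := ε / 2) (by linarith) hα
    fun i => by linarith⟩

theorem PositiveAssociation.openDiffSet_disjoint [Fintype ι] (hf : PositiveAssociation f)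
    {x y : A} (hxy : x ≠ y) {α β : ι → ℝ} (hα : α ∈ openDiffSet f x y)
    (hβ : β ∈ openDiffSet f y x) : ¬ ∀ i, α i + β i ≤ 0 := by
  obtain ⟨ε, hε, hα⟩ := hα
  obtain ⟨δ, hδ, hβ⟩ := hβ
  exact fun h => hf.diffSet_disjoint hxy hα hβ fun i => by linarith [h i]

theorem PositiveAssociation.neg_mem_openDiffSet [Fintype ι] (hf : PositiveAssociation f)
    (hs : Function.Surjective f) {x y : A} (hxy : x ≠ y) {α : ι → ℝ}
    (hα : α ∉ openDiffSet f x y) {ε : ℝ} (hε : 0 < ε) :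
    (fun i => -α i + ε) ∈ openDiffSet f y x := by
  have h1 : (fun i => α i - ε / 2) ∉ diffSet f x y := fun h => hα ⟨ε / 2, by linarith, h⟩
  refine hf.mem_openDiffSet hxy.symm (ε := ε / 2) (by linarith)
    (hf.neg_mem_diffSet hs hxy h1) fun i => ?_
  simp only [Pi.neg_apply]; linarith

theorem PositiveAssociation.openDiffSet_trans [Fintype ι] (hf : PositiveAssociation f)
    (hs : Function.Surjective f) {x y z : A} (hxy : x ≠ y) (hyz : y ≠ z) (hxz : x ≠ z)
    {α β : ι → ℝ} (hα : α ∈ openDiffSet f x y) (hβ : β ∈ openDiffSet f y z) :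
    α + β ∈ openDiffSet f x z := by
  obtain ⟨ε, hε, hα⟩ := hα
  obtain ⟨δ, hδ, hβ⟩ := hβ
  exact ⟨(ε + δ) / 2, by linarith, hf.diffSet_trans hs hxy hyz hxz hα hβ
    fun i => by simp only [Pi.add_apply]; linarith⟩

/-! ### Thresholds and their additivity -/

/-- The least uniform advantage of `x` over `y` from which on `x` beats `y`. -/
noncomputable def threshold (f : (ι → A → ℝ) → A) (x y : A) : ℝ :=
  sInf {r : ℝ | (fun _ => r) ∈ openDiffSet f x y}

theorem PositiveAssociation.exists_const_mem_openDiffSet [Fintype ι]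
    (hf : PositiveAssociation f) (hs : Function.Surjective f) {x y : A} (hxy : x ≠ y) :
    ∃ r : ℝ, (fun _ => r) ∈ openDiffSet f x y := by
  obtain ⟨v, hv⟩ := hs x
  refine ⟨∑ i, |v i x - v i y| + 1, hf.mem_openDiffSet hxy one_pos ⟨v, hv, fun i => rfl⟩
    fun i => ?_⟩
  have h1 := Finset.single_le_sum (f := fun i => |v i x - v i y|)
    (fun i _ => abs_nonneg _) (Finset.mem_univ i)
  linarith [le_abs_self (v i x - v i y)]

theorem PositiveAssociation.bddBelow_const [Fintype ι] [Nonempty ι]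
    (hf : PositiveAssociation f) (hs : Function.Surjective f) {x y : A} (hxy : x ≠ y) :
    BddBelow {r : ℝ | (fun _ => r) ∈ openDiffSet f x y} := by
  obtain ⟨q, hq⟩ := hf.exists_const_mem_openDiffSet hs hxy.symm
  refine ⟨-q, fun r hr => ?_⟩
  by_contra h
  exact hf.openDiffSet_disjoint hxy hr hq fun i => by linarith

theorem PositiveAssociation.const_mem_of_threshold_lt [Fintype ι]
    (hf : PositiveAssociation f) (hs : Function.Surjective f) {x y : A} (hxy : x ≠ y) {r : ℝ}
    (h : threshold f x y < r) : (fun _ => r) ∈ openDiffSet f x y := by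
  obtain ⟨q, hq, hqr⟩ := exists_lt_of_csInf_lt (hf.exists_const_mem_openDiffSet hs hxy) h
  exact hf.openDiffSet_mono hxy hq fun _ => hqr.le

theorem PositiveAssociation.threshold_le [Fintype ι] [Nonempty ι]
    (hf : PositiveAssociation f) (hs : Function.Surjective f) {x y : A} (hxy : x ≠ y) {r : ℝ}
    (h : (fun _ => r) ∈ openDiffSet f x y) : threshold f x y ≤ r :=
  csInf_le (hf.bddBelow_const hs hxy) h

theorem PositiveAssociation.threshold_swap [Fintype ι] [Nonempty ι]
    (hf : PositiveAssociation f) (hs : Function.Surjective f) {x y : A} (hxy : x ≠ y) :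
    threshold f y x = -threshold f x y := by
  apply le_antisymm
  · refine le_of_forall_pos_le_add fun ε hε => ?_
    have h1 : (fun _ => threshold f x y - ε / 2) ∉ openDiffSet f x y := fun h => by
      linarith [hf.threshold_le hs hxy h]
    have h2 := hf.neg_mem_openDiffSet hs hxy h1 (half_pos hε)
    linarith [hf.threshold_le hs hxy.symm h2]
  · by_contra! h
    set d := -threshold f x y - threshold f y x
    have h1 := hf.const_mem_of_threshold_lt hs hxy
      (r := threshold f x y + d / 2) (by simp only [d]; linarith)
    have h2 := hf.const_mem_of_threshold_lt hs hxy.symm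
      (r := threshold f y x + d / 2) (by simp only [d]; linarith)
    exact hf.openDiffSet_disjoint hxy h1 h2 fun _ => by simp only [d]; linarith

theorem PositiveAssociation.threshold_triangle [Fintype ι] [Nonempty ι]
    (hf : PositiveAssociation f) (hs : Function.Surjective f) {x y z : A} (hxy : x ≠ y)
    (hyz : y ≠ z) (hxz : x ≠ z) :
    threshold f x z ≤ threshold f x y + threshold f y z := by
  refine le_of_forall_pos_le_add fun ε hε => ?_
  have h1 := hf.const_mem_of_threshold_lt hs hxy
    (r := threshold f x y + ε / 2) (by linarith)
  have h2 := hf.const_mem_of_threshold_lt hs hyz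
    (r := threshold f y z + ε / 2) (by linarith)
  have h3 := hf.threshold_le hs hxz (r := _ + _) (hf.openDiffSet_trans hs hxy hyz hxz h1 h2)
  linarith

/-- The reverse inequality is the triangle inequality for `x`, `z`, `y` combined with antisymmetry.
-/
theorem PositiveAssociation.threshold_add [Fintype ι] [Nonempty ι]
    (hf : PositiveAssociation f) (hs : Function.Surjective f) {x y z : A} (hxy : x ≠ y)
    (hyz : y ≠ z) (hxz : x ≠ z) :
    threshold f x z = threshold f x y + threshold f y z := by
  have h1 := hf.threshold_triangle hs hxy hyz hxz
  have h2 := hf.threshold_triangle hs hxz hyz.symm hxy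
  rw [hf.threshold_swap hs hyz] at h2
  linarith

/-! ### Centered difference sets do not depend on the pair -/

/-- `openDiffSet`, translated so that its threshold becomes zero. -/
def centeredDiffSet (f : (ι → A → ℝ) → A) (x y : A) : Set (ι → ℝ) :=
  {α | (fun i => α i + threshold f x y) ∈ openDiffSet f x y}

theorem PositiveAssociation.const_mem_centeredDiffSet [Fintype ι]
    (hf : PositiveAssociation f) (hs : Function.Surjective f) {x y : A} (hxy : x ≠ y) {ε : ℝ}
    (hε : 0 < ε) : (fun _ => ε) ∈ centeredDiffSet f x y :=
  hf.const_mem_of_threshold_lt hs hxy (by linarith)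

theorem PositiveAssociation.centeredDiffSet_mono (hf : PositiveAssociation f) {x y : A}
    (hxy : x ≠ y) {α β : ι → ℝ} (hα : α ∈ centeredDiffSet f x y) (h : ∀ i, α i ≤ β i) :
    β ∈ centeredDiffSet f x y :=
  hf.openDiffSet_mono hxy hα fun i => by linarith [h i]

theorem PositiveAssociation.exists_sub_mem_centeredDiffSet (hf : PositiveAssociation f)
    {x y : A} (hxy : x ≠ y) {α : ι → ℝ} (hα : α ∈ centeredDiffSet f x y) :
    ∃ ε : ℝ, 0 < ε ∧ (fun i => α i - ε) ∈ centeredDiffSet f x y := by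
  obtain ⟨ε, hε, h⟩ := hf.exists_sub_mem_openDiffSet hxy hα
  exact ⟨ε, hε, hf.openDiffSet_mono hxy h fun i => by linarith⟩

theorem PositiveAssociation.centeredDiffSet_trans [Fintype ι] [Nonempty ι]
    (hf : PositiveAssociation f) (hs : Function.Surjective f) {x y z : A} (hxy : x ≠ y)
    (hyz : y ≠ z) (hxz : x ≠ z) {α β : ι → ℝ} (hα : α ∈ centeredDiffSet f x y)
    (hβ : β ∈ centeredDiffSet f y z) : α + β ∈ centeredDiffSet f x z := by
  refine hf.openDiffSet_mono hxz (hf.openDiffSet_trans hs hxy hyz hxz hα hβ) fun i => ?_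
  simp only [Pi.add_apply, hf.threshold_add hs hxy hyz hxz]
  linarith

/-- Openness leaves room to subtract `ε`, and transitivity restores it using the constant `ε` for
the pair `y`, `z`. -/
theorem PositiveAssociation.centeredDiffSet_subset_right [Fintype ι] [Nonempty ι]
    (hf : PositiveAssociation f) (hs : Function.Surjective f) {x y z : A} (hxy : x ≠ y)
    (hyz : y ≠ z) (hxz : x ≠ z) : centeredDiffSet f x y ⊆ centeredDiffSet f x z := by
  intro α hα
  obtain ⟨ε, hε, h⟩ := hf.exists_sub_mem_centeredDiffSet hxy hα
  exact hf.centeredDiffSet_mono hxz (hf.centeredDiffSet_trans hs hxy hyz hxz h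
    (hf.const_mem_centeredDiffSet hs hyz hε)) fun i => by simp

theorem PositiveAssociation.centeredDiffSet_subset_left [Fintype ι] [Nonempty ι]
    (hf : PositiveAssociation f) (hs : Function.Surjective f) {x y z : A} (hxy : x ≠ y)
    (hxz : x ≠ z) (hzy : z ≠ y) : centeredDiffSet f x y ⊆ centeredDiffSet f z y := by
  intro α hα
  obtain ⟨ε, hε, h⟩ := hf.exists_sub_mem_centeredDiffSet hxy hα
  exact hf.centeredDiffSet_mono hzy (hf.centeredDiffSet_trans hs hxz.symm hxy hzy
    (hf.const_mem_centeredDiffSet hs hxz.symm hε) h) fun i => by simp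

/-- A third alternative `z` gives the route `(x, y)`, `(x, z)`, `(y, z)`, `(y, x)`, changing one
entry at a time. -/
theorem PositiveAssociation.centeredDiffSet_subset_swap [Fintype ι] [Nonempty ι] [Fintype A]
    (hA : 3 ≤ Fintype.card A) (hf : PositiveAssociation f) (hs : Function.Surjective f)
    {x y : A} (hxy : x ≠ y) : centeredDiffSet f x y ⊆ centeredDiffSet f y x := by
  classical
  obtain ⟨z, hz⟩ : ∃ z, z ∉ ({x, y} : Finset A) := by
    by_contra! h
    have := Finset.card_le_card (fun a _ => h a : Finset.univ ⊆ ({x, y} : Finset A))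
    have := Finset.card_le_two (a := x) (b := y)
    simp only [Finset.card_univ] at *
    omega
  obtain ⟨hzx, hzy⟩ : z ≠ x ∧ z ≠ y := by simpa using hz
  exact ((hf.centeredDiffSet_subset_right hs hxy hzy.symm hzx.symm).trans
    (hf.centeredDiffSet_subset_left hs hzx.symm hxy hzy.symm)).trans
    (hf.centeredDiffSet_subset_right hs hzy.symm hzx hxy.symm)

theorem PositiveAssociation.centeredDiffSet_subset [Fintype ι] [Nonempty ι] [Fintype A]
    (hA : 3 ≤ Fintype.card A) (hf : PositiveAssociation f) (hs : Function.Surjective f)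
    {x y x' y' : A} (hxy : x ≠ y) (hxy' : x' ≠ y') :
    centeredDiffSet f x y ⊆ centeredDiffSet f x' y' := by
  have right : ∀ {x y z : A}, x ≠ y → x ≠ z → centeredDiffSet f x y ⊆ centeredDiffSet f x z := by
    intro x y z hxy hxz
    by_cases hyz : y = z
    · rw [hyz]
    · exact hf.centeredDiffSet_subset_right hs hxy hyz hxz
  have left : ∀ {x y z : A}, x ≠ y → z ≠ y → centeredDiffSet f x y ⊆ centeredDiffSet f z y := by
    intro x y z hxy hzy
    by_cases hxz : x = z
    · rw [hxz]
    · exact hf.centeredDiffSet_subset_left hs hxy hxz hzy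
  by_cases h : x = y'
  · subst h
    exact (hf.centeredDiffSet_subset_swap hA hs hxy).trans (left hxy.symm hxy')
  · exact (right hxy h).trans (left h hxy')

/-! ### Weights by separation, and the affine maximizer -/

/-- A set of vectors that behaves like the open half space of a nonnegative nonzero functional
is contained in such a half space. -/
theorem exists_weights_of_cone [Fintype ι] [Nonempty ι] {C : Set (ι → ℝ)}
    (hmono : ∀ {α β : ι → ℝ}, α ∈ C → (∀ i, α i ≤ β i) → β ∈ C)
    (hsub : ∀ {α : ι → ℝ}, α ∈ C → ∃ ε : ℝ, 0 < ε ∧ (fun i => α i - ε) ∈ C)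
    (hadd : ∀ {α β : ι → ℝ}, α ∈ C → β ∈ C → α + β ∈ C)
    (hconst : ∀ {ε : ℝ}, 0 < ε → (fun _ => ε) ∈ C)
    (hzero : (0 : ι → ℝ) ∉ C)
    (hneg : ∀ {α : ι → ℝ}, α ∉ C → ∀ {ε : ℝ}, 0 < ε → (fun i => -α i + ε) ∈ C) :
    ∃ w ∈ stdSimplex ℝ ι, ∀ α ∈ C, 0 < ∑ i, w i * α i := by
  classical
  have hnsmul : ∀ (n : ℕ) {α : ι → ℝ}, α ∈ C → ((n : ℝ) + 1) • α ∈ C := by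
    intro n α hα
    induction n with
    | zero => simpa using hα
    | succ n ih =>
      rw [Nat.cast_succ, add_smul (R := ℝ) _ 1, one_smul]
      exact hadd ih hα
  have hdiv : ∀ (n : ℕ) {α : ι → ℝ}, α ∈ C → ((n : ℝ) + 1)⁻¹ • α ∈ C := by
    intro n α hα
    -- Otherwise a slight increase of `-α / (n + 1)` lies in `C`; its `(n + 1)`-fold multiple
    -- cancels `α - ε`, putting zero in `C`.
    by_contra h
    have hn : (0 : ℝ) < n + 1 := by positivity
    obtain ⟨ε, hε, hα'⟩ := hsub hα
    have h1 := hadd hα' (hnsmul n (hneg h (div_pos hε hn)))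
    apply hzero
    convert h1 using 1
    funext i
    simp only [Pi.zero_apply, Pi.add_apply, Pi.smul_apply, smul_eq_mul]
    field_simp
    ring
  have hrat : ∀ (q : ℚ) {α : ι → ℝ}, 0 < (q : ℝ) → α ∈ C → (q : ℝ) • α ∈ C := by
    intro q α hq hα
    have hq' : 0 < q := by exact_mod_cast hq
    have h1 := hdiv (q.den - 1) (hnsmul (q.num.natAbs - 1) hα)
    have hnum : 0 < q.num := Rat.num_pos.mpr hq'
    have h2 : ((q.num.natAbs - 1 : ℕ) : ℝ) + 1 = (q.num : ℝ) := by
      have : ((q.num.natAbs - 1 : ℕ) : ℤ) + 1 = q.num := by omega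
      exact_mod_cast this
    have h3 : ((q.den - 1 : ℕ) : ℝ) + 1 = (q.den : ℝ) := by
      have : (q.den - 1 : ℕ) + 1 = q.den := Nat.sub_add_cancel q.pos
      exact_mod_cast this
    rw [h2, h3, smul_smul] at h1
    rw [Rat.cast_def, div_eq_inv_mul]
    exact h1
  have hsmul : ∀ {t : ℝ} {α : ι → ℝ}, 0 < t → α ∈ C → t • α ∈ C := by
    intro t α ht hα
    obtain ⟨ε, hε, hα'⟩ := hsub hα
    -- The slack `ε` lets a rational near `t` replace `t`, after which monotonicity concludes.
    have hopen : IsOpen {s : ℝ | 0 < s ∧ ∀ i, s * (α i - ε) < t * α i} := by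
      rw [Set.ofPred_and, Set.ofPred_forall]
      exact (isOpen_lt continuous_const continuous_id).inter
        (isOpen_iInter_of_finite fun i => isOpen_lt (by fun_prop) (by fun_prop))
    obtain ⟨q, hq, hqi⟩ := Rat.denseRange_cast.exists_mem_open hopen
      ⟨t, ht, fun i => by nlinarith⟩
    exact hmono (hrat q hq hα') fun i => (hqi i).le
  have hconv : Convex ℝ C := by
    rw [convex_iff_forall_pos]
    exact fun α hα β hβ a b ha hb _ => hadd (hsmul ha hα) (hsmul hb hβ)
  have hCopen : IsOpen C := by
    rw [Metric.isOpen_iff]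
    intro α hα
    obtain ⟨ε, hε, hα'⟩ := hsub hα
    refine ⟨ε, hε, fun β hβ => hmono hα' fun i => ?_⟩
    have h1 := (dist_pi_lt_iff hε).mp (Metric.mem_ball.mp hβ) i
    rw [Real.dist_eq] at h1
    linarith [(abs_lt.mp h1).1]
  obtain ⟨g, hg⟩ := geometric_hahn_banach_point_open hconv hCopen hzero
  have hgsum : ∀ α : ι → ℝ, g α = ∑ i, g (Pi.single i 1) * α i := by
    intro α
    conv_lhs => rw [← Finset.univ_sum_single α, map_sum]
    refine Finset.sum_congr rfl fun i _ => ?_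
    have : (Pi.single i (α i) : ι → ℝ) = α i • Pi.single i 1 := by
      rw [← Pi.single_smul]; simp
    rw [this, map_smul, smul_eq_mul, mul_comm]
  simp only [map_zero] at hg
  have hnonneg : ∀ i, 0 ≤ g (Pi.single i 1) := by
    intro i
    have hpos : 0 < g (fun _ => (1 : ℝ)) := hg _ (hconst one_pos)
    by_contra! hi
    -- This `δ` makes `g` vanish at a vector that monotonicity places in `C`.
    obtain ⟨δ, hδ, hδ'⟩ : ∃ δ : ℝ, 0 < δ ∧ δ * g (fun _ => (1 : ℝ)) = -g (Pi.single i 1) :=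
      ⟨_, div_pos (neg_pos.mpr hi) hpos, div_mul_cancel₀ _ hpos.ne'⟩
    have h1 : Pi.single i 1 + δ • (fun _ => (1 : ℝ)) ∈ C := by
      refine hmono (hconst hδ) fun j => ?_
      simp only [Pi.add_apply, Pi.smul_apply, smul_eq_mul, mul_one, le_add_iff_nonneg_left]
      by_cases hj : j = i
      · subst hj; simp
      · simp [hj]
    have h2 := hg _ h1
    rw [map_add, map_smul, smul_eq_mul, hδ'] at h2
    linarith
  have hsum : 0 < ∑ i, g (Pi.single i 1) := by
    have h1 := hg _ (hconst one_pos)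
    rw [hgsum] at h1
    simpa using h1
  refine ⟨fun i => g (Pi.single i 1) / ∑ j, g (Pi.single j 1),
    ⟨fun i => div_nonneg (hnonneg i) hsum.le, ?_⟩, fun α hα => ?_⟩
  · rw [← Finset.sum_div, div_self hsum.ne']
  · have h1 := hg _ hα
    rw [hgsum] at h1
    simp only [div_mul_eq_mul_div]
    rw [← Finset.sum_div]
    exact div_pos h1 hsum

theorem PositiveAssociation.exists_weights [Fintype ι] [Nonempty ι] [Fintype A]
    (hA : 3 ≤ Fintype.card A) (hf : PositiveAssociation f) (hs : Function.Surjective f) :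
    ∃ w ∈ stdSimplex ℝ ι, ∀ x y : A, x ≠ y →
      ∀ α ∈ centeredDiffSet f x y, 0 < ∑ i, w i * α i := by
  obtain ⟨x, y, z, hxy, hxz, hyz⟩ := Fintype.two_lt_card_iff.mp hA
  have hswap : centeredDiffSet f x y ⊆ centeredDiffSet f y x :=
    hf.centeredDiffSet_subset hA hs hxy hxy.symm
  have hswap' : centeredDiffSet f y x ⊆ centeredDiffSet f x y :=
    hf.centeredDiffSet_subset hA hs hxy.symm hxy
  obtain ⟨w, hw, h⟩ := exists_weights_of_cone (C := centeredDiffSet f x y)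
    (hf.centeredDiffSet_mono hxy) (hf.exists_sub_mem_centeredDiffSet hxy)
    (fun hα hβ => hf.centeredDiffSet_subset hA hs hxz hxy
      (hf.centeredDiffSet_trans hs hxy hyz hxz hα
        (hf.centeredDiffSet_subset hA hs hxy hyz hβ)))
    (hf.const_mem_centeredDiffSet hs hxy)
    (fun h0 => hf.openDiffSet_disjoint hxy h0 (hswap h0) fun i => by
      simp [hf.threshold_swap hs hxy])
    (fun {α} hα {ε} hε => hswap' <| hf.openDiffSet_mono hxy.symm
      (hf.neg_mem_openDiffSet hs hxy hα hε) fun i => by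
        rw [hf.threshold_swap hs hxy]; linarith)
  exact ⟨w, hw, fun x' y' hxy' α hα =>
    h α (hf.centeredDiffSet_subset hA hs hxy' hxy hα)⟩

/-- **Roberts' theorem**: with at least three alternatives and unrestricted quasi-linear
valuations, every onto choice rule with positive association of differences is an affine
maximizer. -/
theorem PositiveAssociation.exists_affineMaximizer [Fintype ι] [Nonempty ι] [Fintype A]
    (hA : 3 ≤ Fintype.card A) (hf : PositiveAssociation f) (hs : Function.Surjective f) :
    ∃ w ∈ stdSimplex ℝ ι, ∃ c : A → ℝ, ∀ v a,
      c a + ∑ i, w i * v i a ≤ c (f v) + ∑ i, w i * v i (f v) := by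
  classical
  obtain ⟨w, hw, h⟩ := hf.exists_weights hA hs
  obtain ⟨o⟩ : Nonempty A := Fintype.card_pos_iff.mp (by omega)
  -- Additive thresholds are differences of a potential, here normalized to zero at `o`.
  let c : A → ℝ := fun a => if a = o then 0 else -threshold f a o
  have hc : ∀ x y, x ≠ y → threshold f x y = c y - c x := by
    intro x y hxy
    by_cases hx : x = o
    · subst hx
      simp [c, hxy.symm, hf.threshold_swap hs hxy]
    · by_cases hy : y = o
      · subst hy; simp [c, hxy]
      · simp only [c, hx, hy, if_false]
        rw [hf.threshold_add hs hx (Ne.symm hy) hxy, hf.threshold_swap hs hy]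
        ring
  refine ⟨w, hw, c, fun v a => ?_⟩
  by_cases ha : f v = a
  · rw [ha]
  refine le_of_forall_pos_le_add fun ε hε => ?_
  -- Adding `ε` moves the realized difference vector into the open set.
  have h1 := h _ _ ha (fun i => v i (f v) - v i a + ε - threshold f (f v) a)
    (hf.mem_openDiffSet ha hε ⟨v, rfl, fun i => rfl⟩ fun i => by linarith)
  have h2 : ∑ i, w i * (v i (f v) - v i a + ε - threshold f (f v) a) =
      ∑ i, w i * v i (f v) - ∑ i, w i * v i a + (ε - threshold f (f v) a) * ∑ i, w i := by
    rw [Finset.mul_sum, ← Finset.sum_sub_distrib, ← Finset.sum_add_distrib]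
    exact Finset.sum_congr rfl fun i _ => by ring
  rw [h2, hw.2, hc _ _ ha] at h1
  linarith

end Roberts

/-! ### From pos-representations to quasi-linear mechanisms -/

section Reduction

variable {ι A : Type*}

theorem IsQuasiLinear.eq_sub {u : Util A} (hu : IsQuasiLinear u) (a : A) (z : ℝ) :
    u a z = u a 0 - z := by
  obtain ⟨v, hv⟩ := hu
  rw [hv, hv, sub_zero]

/-- Quasi-linear pos-representations of a preference differ by a constant only. -/
theorem PosRepresents.sub_eq_sub {R : Pref A} {u u' : Util A} (hu : IsQuasiLinear u)
    (hu' : IsQuasiLinear u') (h : PosRepresents u R) (h' : PosRepresents u' R) (a b : A) :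
    u a 0 - u b 0 = u' a 0 - u' b 0 := by
  -- At payment `z` both utilities of `a` are nonnegative, so an indifference under `u` is also one
  -- under `u'`.
  set z := min (u a 0) (u' a 0) with hz
  have h1 : z ≤ u a 0 := min_le_left _ _
  have h2 : z ≤ u' a 0 := min_le_right _ _
  set y := u b 0 - u a 0 + z with hy
  have ha : 0 ≤ u a z := by rw [hu.eq_sub]; linarith
  have ha' : 0 ≤ u' a z := by rw [hu'.eq_sub]; linarith
  have he : u b y = u a z := by rw [hu.eq_sub b, hu.eq_sub a]; linarith
  have h3 := (h' a b z y (Or.inl ha')).mp ((h a b z y (Or.inl ha)).mpr he.le)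
  have h4 := (h' b a y z (Or.inr ha')).mp ((h b a y z (Or.inr ha)).mpr he.ge)
  rw [hu'.eq_sub a, hu'.eq_sub b] at h3 h4
  linarith

/-- Both minima are zero, so the shift is zero. -/
theorem normalizedQL_eq_of_shift {u u' : Util A} (hu : u ∈ normalizedQL A)
    (hu' : u' ∈ normalizedQL A) {k : ℝ} (h : ∀ a, u a 0 = u' a 0 - k) : u = u' := by
  obtain ⟨a, ha⟩ := hu.2.1
  obtain ⟨b, hb⟩ := hu'.2.1
  have h1 : 0 ≤ u' a 0 := hu'.2.2 ⟨a, rfl⟩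
  have h2 : 0 ≤ u b 0 := hu.2.2 ⟨b, rfl⟩
  have h3 := h a
  have h4 := h b
  simp only at ha hb
  funext d z
  rw [hu.1.eq_sub, hu'.1.eq_sub, h]
  linarith

theorem exists_normalizedQL_shift [Finite A] [Nonempty A] (g : A → ℝ) :
    ∃ u ∈ normalizedQL A, ∃ k : ℝ, ∀ a, u a 0 = g a - k := by
  obtain ⟨m, hm⟩ := Finite.exists_min g
  refine ⟨fun a z => g a - g m - z, ⟨⟨fun a => g a - g m, fun _ _ => rfl⟩, ⟨m, by simp⟩, ?_⟩,
    g m, fun a => sub_zero _⟩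
  rintro _ ⟨a, rfl⟩
  simpa using hm a

namespace Mechanism

variable {T : ι → Set (Pref A)} [DecidableEq ι]

/-- Where the truthful outcome has nonnegative utility, incentive compatibility can be read off
from quasi-linear pos-representations. -/
theorem IncentiveCompatible.utility_le {M : Mechanism T} (hM : M.IncentiveCompatible)
    {V : ∀ i, T i → Util A} (hV : IsPosRepChoice T V)
    (hpay : ∀ t i, M.p t i ≤ V i (t i) (M.x t) 0) (t : Profile T) (i : ι) (s : T i) :
    V i (t i) (M.x (Function.update t i s)) 0 - M.p (Function.update t i s) i ≤
      V i (t i) (M.x t) 0 - M.p t i := by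
  have h0 : 0 ≤ V i (t i) (M.x t) (M.p t i) := by
    rw [(hV i (t i)).1.eq_sub]; linarith [hpay t i]
  have h1 := ((hV i (t i)).2 _ _ _ _ (Or.inl h0)).mp (hM t i s)
  rwa [(hV i (t i)).1.eq_sub, (hV i (t i)).1.eq_sub (M.x t)] at h1

/-- Roberts' theorem for mechanisms over normalized quasi-linear utilities. -/
theorem exists_affineMaximizer [Fintype ι] [Fintype A] (hA : 3 ≤ Fintype.card A)
    (φ : ∀ i, T i ≃ normalizedQL A) {M : Mechanism T} (honto : M.Onto)
    (hIC : ∀ t i s, (φ i (t i)).1 (M.x (Function.update t i s)) 0 -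
      M.p (Function.update t i s) i ≤ (φ i (t i)).1 (M.x t) 0 - M.p t i) :
    ∃ w ∈ stdSimplex ℝ ι, ∃ c : A → ℝ, ∀ t a,
      c a + ∑ i, w i * (φ i (t i)).1 a 0 ≤
        c (M.x t) + ∑ i, w i * (φ i (t i)).1 (M.x t) 0 := by
  have : Nontrivial A := Fintype.one_lt_card_iff_nontrivial.mp (by omega)
  -- Without agents there is only one profile, so the choice could not be onto.
  have : Nonempty ι := by
    by_contra hι
    rw [not_nonempty_iff] at hι
    obtain ⟨a, b, hab⟩ := exists_pair_ne A
    obtain ⟨t, rfl⟩ := honto a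
    obtain ⟨t', rfl⟩ := honto b
    exact hab (by rw [Subsingleton.elim t t'])
  choose ν hν k hk using exists_normalizedQL_shift (A := A)
  let τ : ∀ i, (A → ℝ) → T i := fun i g => (φ i).symm ⟨ν g, hν g⟩
  have hτ : ∀ i g a, (φ i (τ i g)).1 a 0 = g a - k g := fun i g a => by simp [τ, hk]
  have hτ' : ∀ (t : Profile T), (fun i => τ i fun a => (φ i (t i)).1 a 0) = t := by
    intro t
    funext i
    apply (φ i).injective
    exact Subtype.ext (normalizedQL_eq_of_shift (φ i _).2 (φ i _).2 fun a => hτ i _ a)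
  let f : (ι → A → ℝ) → A := fun v => M.x fun i => τ i (v i)
  have hs : Function.Surjective f := by
    intro a
    obtain ⟨t, rfl⟩ := honto a
    exact ⟨fun i a => (φ i (t i)).1 a 0, congrArg M.x (hτ' t)⟩
  -- The constant `k` occurs on both sides of each agent's incentive constraint and cancels.
  have hf : PositiveAssociation f := by
    refine positiveAssociation_of_incentiveCompatible (p := fun v => M.p fun i => τ i (v i))
      fun v i s => ?_
    have h1 : (fun j => τ j (Function.update v i s j)) =
        Function.update (fun j => τ j (v j)) i (τ i s) :=
      funext fun j => Function.apply_update (fun j => τ j) v i s j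
    have h2 := hIC (fun j => τ j (v j)) i (τ i s)
    simp only [f, h1]
    simp only [hτ] at h2
    linarith
  obtain ⟨w, hw, c, h⟩ := hf.exists_affineMaximizer hA hs
  refine ⟨w, hw, c, fun t a => ?_⟩
  have h1 := h (fun i a => (φ i (t i)).1 a 0) a
  simp only [f, hτ' t] at h1
  exact h1

theorem eq_update_of_others_eq {t t' : Profile T} {i : ι} (h : others t i = others t' i) :
    t' = Function.update t i (t' i) := by
  funext j
  by_cases hj : j = i
  · subst hj; simp
  · rw [Function.update_of_ne hj]
    exact (congrFun h ⟨j, hj⟩).symm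

/-! ### Payments -/

variable {M : Mechanism T} {U : ∀ i, T i → Util A}

theorem payment_eq_of_x_eq
    (hIC : ∀ t i s, U i (t i) (M.x (Function.update t i s)) 0 -
      M.p (Function.update t i s) i ≤ U i (t i) (M.x t) 0 - M.p t i)
    {t t' : Profile T} {i : ι} (h : others t i = others t' i) (hx : M.x t = M.x t') :
    M.p t i = M.p t' i := by
  have h1 := hIC t i (t' i)
  have h2 := hIC t' i (t i)
  rw [← eq_update_of_others_eq h, hx] at h1
  rw [← eq_update_of_others_eq h.symm, hx] at h2
  linarith

variable [Fintype ι] {w : ι → ℝ} {c : A → ℝ}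

/-- Revenue equivalence for an agent of positive weight in an affine maximizer. -/
theorem payment_add_externality_le
    (hmax : ∀ t a, c a + ∑ i, w i * U i (t i) a 0 ≤
      c (M.x t) + ∑ i, w i * U i (t i) (M.x t) 0)
    (hIC : ∀ t i s, U i (t i) (M.x (Function.update t i s)) 0 -
      M.p (Function.update t i s) i ≤ U i (t i) (M.x t) 0 - M.p t i)
    {i : ι} (hrich : ∀ g : A → ℝ, ∃ s : T i, ∀ a b, U i s a 0 - U i s b 0 = g a - g b)
    (hw : 0 < w i) {t t' : Profile T} (h : others t i = others t' i) :
    M.p t i + 1 / w i * (c (M.x t) + ∑ j ∈ Finset.univ.erase i, w j * U j (t j) (M.x t) 0) ≤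
      M.p t' i +
        1 / w i * (c (M.x t') + ∑ j ∈ Finset.univ.erase i, w j * U j (t' j) (M.x t') 0) := by
  classical
  have ht' : ∀ a, ∑ j ∈ Finset.univ.erase i, w j * U j (t' j) a 0 =
      ∑ j ∈ Finset.univ.erase i, w j * U j (t j) a 0 := fun a =>
    Finset.sum_congr rfl fun j hj => by
      rw [show t' j = t j from (congrFun h ⟨j, Finset.ne_of_mem_erase hj⟩).symm]
  rw [ht']
  set K : A → ℝ := fun a =>
    1 / w i * (c a + ∑ j ∈ Finset.univ.erase i, w j * U j (t j) a 0) with hK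
  change M.p t i + K (M.x t) ≤ M.p t' i + K (M.x t')
  refine le_of_forall_pos_le_add fun ε hε => ?_
  -- The report `r` offsets costs and the others' welfare, leaving a bonus `ε` that makes `M.x t`
  -- the unique maximizer. Its incentive constraint against `t' i` is the claim up to `ε`.
  obtain ⟨r, hr⟩ := hrich fun d => -K d + if d = M.x t then ε else 0
  have htot : ∀ a, c a + ∑ j, w j * U j (Function.update t i r j) a 0 =
      w i * (U i r a 0 + K a) := by
    intro a
    rw [← Finset.add_sum_erase _ _ (Finset.mem_univ i), Function.update_self]
    have : ∑ j ∈ Finset.univ.erase i, w j * U j (Function.update t i r j) a 0 =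
        ∑ j ∈ Finset.univ.erase i, w j * U j (t j) a 0 :=
      Finset.sum_congr rfl fun j hj => by
        rw [Function.update_of_ne (Finset.ne_of_mem_erase hj)]
    rw [this, hK]
    field_simp
    ring
  have hxr : M.x (Function.update t i r) = M.x t := by
    by_contra hne
    have h1 := hmax (Function.update t i r) (M.x t)
    rw [htot, htot] at h1
    have h2 := le_of_mul_le_mul_left h1 hw
    have h3 := hr (M.x t) (M.x (Function.update t i r))
    simp only [hne, if_true, if_false] at h3
    linarith
  have hoth : others t i = others (Function.update t i r) i := by
    funext j
    exact (Function.update_of_ne j.2 r t).symm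
  have hp := payment_eq_of_x_eq hIC hoth hxr.symm
  have h1 := hIC (Function.update t i r) i (t' i)
  rw [Function.update_idem, ← eq_update_of_others_eq h, Function.update_self, hxr, ← hp] at h1
  have h2 := hr (M.x t) (M.x t')
  by_cases hx : M.x t' = M.x t
  · rw [hx] at h1 ⊢; linarith
  · simp only [hx, if_true, if_false] at h2
    linarith

theorem isVCGWith_of_affineMaximizer (hw : ∀ i, 0 ≤ w i)
    (hmax : ∀ t a, c a + ∑ i, w i * U i (t i) a 0 ≤
      c (M.x t) + ∑ i, w i * U i (t i) (M.x t) 0)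
    (hIC : ∀ t i s, U i (t i) (M.x (Function.update t i s)) 0 -
      M.p (Function.update t i s) i ≤ U i (t i) (M.x t) 0 - M.p t i)
    (hrich : ∀ i (g : A → ℝ), ∃ s : T i, ∀ a b, U i s a 0 - U i s b 0 = g a - g b) :
    M.IsVCGWith Set.univ w c U := by
  refine ⟨fun t => ⟨Set.mem_univ _, fun a _ => hmax t a⟩, fun i => ?_⟩
  have hne : Nonempty (Profile T) := ⟨fun j => (hrich j 0).choose⟩
  -- `ρ` picks a reference profile for each `t₋ᵢ`; `h` is read off there.
  let ρ : OthersProfile T i → Profile T := Function.invFun fun t => others t i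
  have hρ : ∀ t, others (ρ (others t i)) i = others t i := fun t =>
    Function.invFun_eq (f := fun t : Profile T => others t i) ⟨t, rfl⟩
  rcases (hw i).eq_or_lt with hi | hi
  · refine ⟨fun o => M.p (ρ o) i, fun t => ⟨fun h => absurd hi h.ne, fun _ =>
      ⟨fun hno => ?_, fun s hs => ?_⟩⟩⟩
    · refine payment_eq_of_x_eq hIC (hρ t).symm ?_
      rw [eq_update_of_others_eq (hρ t).symm, hno]
    · have h : others (Function.update t i s) i = others t i := by
        funext j
        exact Function.update_of_ne j.2 s t
      exact payment_eq_of_x_eq hIC h hs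
  · refine ⟨fun o => M.p (ρ o) i + 1 / w i * (c (M.x (ρ o)) +
      ∑ j ∈ Finset.univ.erase i, w j * U j (ρ o j) (M.x (ρ o)) 0), fun t =>
      ⟨fun _ => ?_, fun h => absurd h hi.ne'⟩⟩
    have h1 := payment_add_externality_le hmax hIC (hrich i) hi (hρ t)
    have h2 := payment_add_externality_le hmax hIC (hrich i) hi (hρ t).symm
    linarith

theorem isPosRepVCG_of_incentiveCompatible [Fintype A] (hA : 3 ≤ Fintype.card A)
    (φ : ∀ i, T i ≃ normalizedQL A) (hφ : ∀ i (s : T i), PosRepresents (φ i s).1 s.1)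
    (honto : M.Onto) (hpay : ∀ t i, M.p t i ≤ (φ i (t i)).1 (M.x t) 0)
    (hM : M.IncentiveCompatible) :
    ∃ (w : ι → ℝ) (c : A → ℝ), M.IsPosRepVCG Set.univ w c := by
  have : Nonempty A := Fintype.card_pos_iff.mp (by omega)
  have hV : IsPosRepChoice T fun i s => (φ i s).1 := fun i s => ⟨(φ i s).2.1, hφ i s⟩
  have hIC := hM.utility_le hV hpay
  obtain ⟨w, hw, c, hmax⟩ := exists_affineMaximizer hA φ honto hIC
  refine ⟨w, c, Set.univ_nonempty, hw, ⟨_, hV⟩, fun U hU => ?_⟩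
  have hsub : ∀ i (s : T i) a b, U i s a 0 - U i s b 0 = (φ i s).1 a 0 - (φ i s).1 b 0 :=
    fun i s a b => PosRepresents.sub_eq_sub (hU i s).1 (hV i s).1 (hU i s).2 (hV i s).2 a b
  refine isVCGWith_of_affineMaximizer hw.1 (fun t a => ?_) (fun t i s => ?_) fun i g => ?_
  · have h1 : ∑ i, w i * U i (t i) a 0 - ∑ i, w i * U i (t i) (M.x t) 0 =
        ∑ i, w i * (φ i (t i)).1 a 0 - ∑ i, w i * (φ i (t i)).1 (M.x t) 0 := by
      simp only [← Finset.sum_sub_distrib, ← mul_sub, hsub]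
    linarith [hmax t a]
  · linarith [hIC t i s, hsub i (t i) (M.x (Function.update t i s)) (M.x t)]
  · obtain ⟨u, hu, k, hk⟩ := exists_normalizedQL_shift g
    refine ⟨(φ i).symm ⟨u, hu⟩, fun a b => ?_⟩
    rw [hsub]
    simp [hk]

end Mechanism

end Reduction

end PosRepMech

theorem mainTheorem8 {ι A Ω : Type*} [Fintype ι] [DecidableEq ι] [Fintype A]
    [MeasurableSpace Ω]
    (hA : 3 ≤ Fintype.card A)
    (T : ι → Set (PosRepMech.Pref A))
    (hT : ∀ i, T i ⊆ PosRepMech.admissibleTypes A)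
    (φ : ∀ i, T i ≃ PosRepMech.normalizedQL A)
    (hφ : ∀ i (s : T i), PosRepMech.PosRepresents (φ i s).1 s.1)
    (R : PosRepMech.RandomizedMechanism T Ω)
    (honto : ∀ ω, (R.mech ω).Onto)
    (hpay : ∀ ω (t : PosRepMech.Profile T) (i : ι),
      (R.mech ω).p t i ≤ (φ i (t i)).1 ((R.mech ω).x t) 0)
    (htruth : R.UniversallyTruthful) :
    R.IsLotteryOver
      {M | ∃ (w : ι → ℝ) (c : A → ℝ), M.IsPosRepVCG Set.univ w c} := by
  exact fun ω => PosRepMech.Mechanism.isPosRepVCG_of_incentiveCompatible hA φ hφ (honto ω)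
    (hpay ω) (htruth ω)
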